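/- Let $\mathbb{H}^3$ be oriented hyperbolic 3-space, and let $\mathrm{Spin}\cong SL(2,\mathbb{C})$ be the double (universal) cover of its bundle $\mathrm{Fr}\cong PSL(2,\mathbb{C})$ of right-handed orthonormal frames; its points are called spin frames. Rotations and parallel translations of spin frames are defined by lifting the corresponding continuous paths of frames. For a horosphere $h$, let $N^{out}$ be its unit normal pointing towards its centre and $N^{in}=-N^{out}$. A spin-decorated horosphere is a horosphere $h$ with a pair $W=(W^{in},W^{out})$, where, for some unit parallel tangent vector field $V$ on $h$ (that is, one invariant under the parabolic isometries preserving $h$), $W^{in}$ and $W^{out}$ are continuous lifts to $\mathrm{Spin}$ of the frame fields $(N^{in},V,N^{in}\times V)$ and $(N^{out},V,N^{out}\times V)$ along $h$, such that $W^{in}$ is obtained from $W^{out}$ by rotation by $\pi$ about $V$ (equivalently, $W^{out}$ is obtained from $W^{in}$ by rotation by $-\pi$ about $V$). The complex lambda length $\lambda$ from $(h,W)$ to $(h',W')$ is $0$ if $h,h'$ have the same centre. Otherwise let $\gamma$ be the oriented geodesic from the centre of $h$ to the centre of $h'$, meeting them at $q$ and $q'$. Then $\lambda=\exp\left(\tfrac12(\rho+i\theta)\right)$,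 where parallel translation along $\gamma$ by signed distance $\rho$ followed by rotation about $\gamma$ by angle $\theta$ takes the spin frame $W^{in}(q)$ to $W'^{out}(q')$; here $\theta$ is determined modulo $4\pi$. Theorem. Let $(h_i,W_i)$, $i=0,1,2,3$, be any four spin-decorated horospheres in $\mathbb{H}^3$ (for example, horospheres about the vertices of an ideal tetrahedron). Then the complex lambda lengths $\lambda_{ij}$ from $(h_i,W_i)$ to $(h_j,W_j)$ are well-defined complex numbers, and $$\lambda_{02}\lambda_{13}=\lambda_{01}\lambda_{23}+\lambda_{03}\lambda_{12}.$$ -/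

import Mathlib

open scoped MatrixGroups

namespace SpinHoro

/-- Minkowski space `ℝ^{1,3}` with coordinates `(T, X, Y, Z)`. -/
abbrev Mink : Type := Fin 4 → ℝ

/-- The Minkowski inner product `TT' - XX' - YY' - ZZ'`. -/
def mink (p p' : Mink) : ℝ := p 0 * p' 0 - p 1 * p' 1 - p 2 * p' 2 - p 3 * p' 3

/-- The positive light cone `L⁺`. Its rays are the points at infinity of hyperbolic space. -/
def lightCone : Set Mink := {p | mink p p = 0 ∧ 0 < p 0}

/-- Hyperbolic 3-space `ℍ³` in the hyperboloid model. The tangent space at `q` is the Minkowski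
orthogonal complement of `q`, with Riemannian metric `-mink`. -/
def H3 : Set Mink := {x | mink x x = 1 ∧ 0 < x 0}

/-- The cross product `v × w` of tangent vectors at `q ∈ ℍ³`: the tangent vector `c` at `q` with
`-mink c x = det (q, v, w, x)` for all `x`. The orientation of `ℍ³` is the one for which the
directions `X, Y, Z` at `(1, 0, 0, 0)` are right-handed. -/
noncomputable def cross (q v w : Mink) : Mink := fun i =>
  (if i = 0 then -1 else 1) * Matrix.det (Matrix.of ![q, v, w, Pi.single i 1])

/-! ### Right-handed orthonormal frames -/

/-- A right-handed orthonormal frame `(e₁, e₂, e₃)` at a point of `ℍ³`. It is determined by the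
point and `e₁, e₂`; the third vector is `Frame.e₃`, equal to `e₁ × e₂`. -/
@[ext] structure Frame where
  pt : Mink
  e₁ : Mink
  e₂ : Mink
  pt_mem : pt ∈ H3
  tan₁ : mink pt e₁ = 0
  tan₂ : mink pt e₂ = 0
  unit₁ : mink e₁ e₁ = -1
  unit₂ : mink e₂ e₂ = -1
  orth : mink e₁ e₂ = 0

/-- The third vector of a frame. -/
noncomputable def Frame.e₃ (f : Frame) : Mink := cross f.pt f.e₁ f.e₂

theorem cross_apply (q v w : Mink) : cross q v w =
    ![-(q 1 * (v 3 * w 2 - v 2 * w 3) + q 2 * (v 1 * w 3 - v 3 * w 1)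
        + q 3 * (v 2 * w 1 - v 1 * w 2)),
      q 0 * (v 2 * w 3 - v 3 * w 2) - q 2 * (v 0 * w 3 - v 3 * w 0)
        + q 3 * (v 0 * w 2 - v 2 * w 0),
      -(q 0 * (v 1 * w 3 - v 3 * w 1) - q 1 * (v 0 * w 3 - v 3 * w 0)
        + q 3 * (v 0 * w 1 - v 1 * w 0)),
      q 0 * (v 1 * w 2 - v 2 * w 1) - q 1 * (v 0 * w 2 - v 2 * w 0)
        + q 2 * (v 0 * w 1 - v 1 * w 0)] := by
  ext i
  fin_cases i <;>
    simp [cross, Matrix.det_succ_row_zero, Fin.sum_univ_succ, Fin.succAbove, Pi.single_apply] <;>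
    ring

theorem mink_cross_self (q v w : Mink) : mink (cross q v w) (cross q v w) =
    -(mink q q * (mink v v * mink w w - mink v w ^ 2)
      - mink q v * (mink q v * mink w w - mink v w * mink q w)
      + mink q w * (mink q v * mink v w - mink v v * mink q w)) := by
  rw [cross_apply]; simp [mink]; ring

theorem mink_cross_left (q v w : Mink) : mink q (cross q v w) = 0 := by
  rw [cross_apply]; simp [mink]; ring

theorem mink_cross_mid (q v w : Mink) : mink v (cross q v w) = 0 := by
  rw [cross_apply]; simp [mink]; ring

theorem mink_cross_right (q v w : Mink) : mink w (cross q v w) = 0 := by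
  rw [cross_apply]; simp [mink]; ring

theorem mink_comm (p q : Mink) : mink p q = mink q p := by simp only [mink]; ring

theorem mink_comb_right (p x y : Mink) (a b : ℝ) :
    mink p (a • x + b • y) = a * mink p x + b * mink p y := by
  simp [mink]; ring

theorem mink_comb_left (p x y : Mink) (a b : ℝ) :
    mink (a • x + b • y) p = a * mink x p + b * mink y p := by
  simp [mink]; ring

theorem Frame.unit₃ (f : Frame) : mink f.e₃ f.e₃ = -1 := by
  rw [Frame.e₃, mink_cross_self, f.tan₁, f.tan₂, f.unit₁, f.unit₂, f.orth, f.pt_mem.1]; norm_num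

/-- A future-pointing unit vector and a unit vector orthogonal to it span a geodesic, which stays
in the upper sheet of the hyperboloid. -/
theorem translate_mem {q v : Mink} (hq : q ∈ H3) (hqv : mink q v = 0) (hv : mink v v = -1)
    (s : ℝ) : Real.cosh s • q + Real.sinh s • v ∈ H3 := by
  obtain ⟨h1, h0⟩ := hq
  have hs := Real.cosh_sq s
  refine ⟨?_, ?_⟩
  · rw [mink_comb_right, mink_comb_left, mink_comb_left, mink_comm v q, h1, hqv, hv]
    linear_combination hs
  · have hlt : v 0 ^ 2 < q 0 ^ 2 := by
      simp only [mink] at h1 hqv hv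
      have e1 : q 1 ^ 2 + q 2 ^ 2 + q 3 ^ 2 = q 0 ^ 2 - 1 := by linarith
      have e2 : v 1 ^ 2 + v 2 ^ 2 + v 3 ^ 2 = v 0 ^ 2 + 1 := by linarith
      have e3 : q 1 * v 1 + q 2 * v 2 + q 3 * v 3 = q 0 * v 0 := by linarith
      have cs : (q 1 * v 1 + q 2 * v 2 + q 3 * v 3) ^ 2 ≤
          (q 1 ^ 2 + q 2 ^ 2 + q 3 ^ 2) * (v 1 ^ 2 + v 2 ^ 2 + v 3 ^ 2) := by
        nlinarith [sq_nonneg (q 1 * v 2 - q 2 * v 1), sq_nonneg (q 1 * v 3 - q 3 * v 1),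
          sq_nonneg (q 2 * v 3 - q 3 * v 2)]
      rw [e1, e2, e3] at cs
      nlinarith
    have hc := Real.cosh_pos s
    have hlt' : |Real.sinh s * v 0| < Real.cosh s * q 0 := by
      apply abs_lt_of_sq_lt_sq _ (by positivity)
      rw [mul_pow, mul_pow, hs]
      nlinarith [sq_nonneg (Real.sinh s), sq_nonneg (v 0)]
    have := (abs_lt.mp hlt').1
    simp only [Pi.add_apply, Pi.smul_apply, smul_eq_mul]
    linarith

/-- Parallel translation of a frame by signed distance `s` along the oriented geodesic through its
point in the direction `e₁`. The vectors `e₂, e₃` are constant along this geodesic as vectors of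
Minkowski space. -/
noncomputable def Frame.translate (f : Frame) (s : ℝ) : Frame where
  pt := Real.cosh s • f.pt + Real.sinh s • f.e₁
  e₁ := Real.sinh s • f.pt + Real.cosh s • f.e₁
  e₂ := f.e₂
  pt_mem := translate_mem f.pt_mem f.tan₁ f.unit₁ s
  tan₁ := by
    rw [mink_comb_right, mink_comb_left, mink_comb_left, mink_comm f.e₁ f.pt, f.pt_mem.1, f.tan₁,
      f.unit₁]
    ring
  tan₂ := by rw [mink_comb_left, f.tan₂, f.orth]; ring
  unit₁ := by
    rw [mink_comb_right, mink_comb_left, mink_comb_left, mink_comm f.e₁ f.pt, f.pt_mem.1, f.tan₁,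
      f.unit₁]
    linear_combination -(Real.cosh_sq s)
  unit₂ := f.unit₂
  orth := by rw [mink_comb_left, f.tan₂, f.orth]; ring

/-- Right-handed rotation of a frame by angle `t` about its first vector. -/
noncomputable def Frame.rotate₁ (f : Frame) (t : ℝ) : Frame where
  pt := f.pt
  e₁ := f.e₁
  e₂ := Real.cos t • f.e₂ + Real.sin t • f.e₃
  pt_mem := f.pt_mem
  tan₁ := f.tan₁
  tan₂ := by rw [mink_comb_right, f.tan₂, Frame.e₃, mink_cross_left]; ring
  unit₁ := f.unit₁
  unit₂ := by
    have h : mink f.e₂ f.e₃ = 0 := mink_cross_right _ _ _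
    rw [mink_comb_right, mink_comb_left, mink_comb_left, mink_comm f.e₃ f.e₂, f.unit₂, h, f.unit₃]
    linear_combination -(Real.sin_sq_add_cos_sq t)
  orth := by rw [mink_comb_right, f.orth, Frame.e₃, mink_cross_mid]; ring

/-- Right-handed rotation of a frame by angle `t` about its second vector. As `e₂ × e₃ = e₁`, it
takes `e₁` to `cos t • e₁ - sin t • e₃`. -/
noncomputable def Frame.rotate₂ (f : Frame) (t : ℝ) : Frame where
  pt := f.pt
  e₁ := Real.cos t • f.e₁ + (-Real.sin t) • f.e₃
  e₂ := f.e₂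
  pt_mem := f.pt_mem
  tan₁ := by rw [mink_comb_right, f.tan₁, Frame.e₃, mink_cross_left]; ring
  tan₂ := f.tan₂
  unit₁ := by
    have h : mink f.e₁ f.e₃ = 0 := mink_cross_mid _ _ _
    rw [mink_comb_right, mink_comb_left, mink_comb_left, mink_comm f.e₃ f.e₁, f.unit₁, h, f.unit₃]
    linear_combination -(Real.sin_sq_add_cos_sq t)
  unit₂ := f.unit₂
  orth := by
    have h : mink f.e₂ f.e₃ = 0 := mink_cross_right _ _ _
    rw [mink_comb_left, f.orth, mink_comm f.e₃ f.e₂, h]; ring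

/-! ### The action of `SL(2,ℂ)` and spin frames -/

/-- The Hermitian matrix `½ (T+Z, X+iY; X-iY, T-Z)` of a point of Minkowski space. -/
noncomputable def toHerm (p : Mink) : Matrix (Fin 2) (Fin 2) ℂ :=
  !![((p 0 + p 3) / 2 : ℂ), (p 1 + p 2 * Complex.I) / 2;
     (p 1 - p 2 * Complex.I) / 2, (p 0 - p 3) / 2]

/-- The inverse of `toHerm` on Hermitian matrices:
`(a, b+ci; b-ci, d) ↦ (a+d, 2b, 2c, a-d)`. -/
noncomputable def ofHerm (S : Matrix (Fin 2) (Fin 2) ℂ) : Mink :=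
  ![(S 0 0 + S 1 1).re, 2 * (S 0 1).re, 2 * (S 0 1).im, (S 0 0 - S 1 1).re]

/-- The action of `SL(2,ℂ)` on Minkowski space, given on Hermitian matrices by `S ↦ A S A*`. It is
linear, so it is also the derivative of the induced isometry of `ℍ³`. -/
noncomputable def act (A : SL(2, ℂ)) (p : Mink) : Mink :=
  ofHerm ((A : Matrix (Fin 2) (Fin 2) ℂ) * toHerm p * (A : Matrix (Fin 2) (Fin 2) ℂ).conjTranspose)

theorem toHerm_act (A : SL(2, ℂ)) (p : Mink) : toHerm (act A p) =
    (A : Matrix (Fin 2) (Fin 2) ℂ) * toHerm p *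
      (A : Matrix (Fin 2) (Fin 2) ℂ).conjTranspose := by
  ext i j
  fin_cases i <;> fin_cases j <;> apply Complex.ext <;>
    simp [act, toHerm, ofHerm, Matrix.mul_apply, Fin.sum_univ_two] <;> ring

theorem mink_self_eq_det (p : Mink) : ((mink p p : ℝ) : ℂ) = 4 * (toHerm p).det := by
  simp only [mink, toHerm, Matrix.det_fin_two_of]
  push_cast
  linear_combination (-(p 2 : ℂ) ^ 2) * Complex.I_sq

theorem mink_act_self (A : SL(2, ℂ)) (p : Mink) : mink (act A p) (act A p) = mink p p := by
  have h : ((mink (act A p) (act A p) : ℝ) : ℂ) = ((mink p p : ℝ) : ℂ) := by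
    rw [mink_self_eq_det, mink_self_eq_det, toHerm_act]
    simp [Matrix.det_mul, Matrix.det_conjTranspose]
  exact_mod_cast h

theorem act_add (A : SL(2, ℂ)) (p q : Mink) : act A (p + q) = act A p + act A q := by
  ext i
  fin_cases i <;> simp [act, toHerm, ofHerm, Matrix.mul_apply, Fin.sum_univ_two] <;> ring

theorem mink_act (A : SL(2, ℂ)) (p q : Mink) : mink (act A p) (act A q) = mink p q := by
  have h := mink_act_self A (p + q)
  rw [act_add] at h
  have hp := mink_act_self A p
  have hq := mink_act_self A q
  simp only [mink, Pi.add_apply] at *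
  linarith

theorem act_base_mem (A : SL(2, ℂ)) : act A ![1, 0, 0, 0] ∈ H3 := by
  have h1 : mink (act A ![1, 0, 0, 0]) (act A ![1, 0, 0, 0]) = 1 := by
    rw [mink_act]; simp [mink]
  have h2 : 0 ≤ act A ![1, 0, 0, 0] 0 := by
    simp [act, toHerm, ofHerm, Matrix.mul_apply, Fin.sum_univ_two]
    nlinarith [sq_nonneg (A 0 0).re, sq_nonneg (A 0 0).im, sq_nonneg (A 0 1).re,
      sq_nonneg (A 0 1).im, sq_nonneg (A 1 0).re, sq_nonneg (A 1 0).im, sq_nonneg (A 1 1).re,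
      sq_nonneg (A 1 1).im]
  refine ⟨h1, lt_of_le_of_ne h2 fun h => ?_⟩
  simp only [mink, ← h] at h1
  nlinarith [sq_nonneg (act A ![1, 0, 0, 0] 1), sq_nonneg (act A ![1, 0, 0, 0] 2),
    sq_nonneg (act A ![1, 0, 0, 0] 3)]

/-- The total space of the spin double cover of the frame bundle of `ℍ³`. Orientation-preserving
isometries act simply transitively on frames, so the frame bundle is `PSL(2,ℂ)`, and its double
(universal) cover is `SL(2,ℂ)`, with the covering map `Spin.frame`. -/
abbrev Spin : Type := SL(2, ℂ)

/-- The covering projection from spin frames to frames: `A` lies over the image under `A` of the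
base frame `(∂_Z, ∂_Y, -∂_X)` at `(1, 0, 0, 0)`. -/
noncomputable def Spin.frame (A : Spin) : Frame where
  pt := act A ![1, 0, 0, 0]
  e₁ := act A ![0, 0, 0, 1]
  e₂ := act A ![0, 0, 1, 0]
  pt_mem := act_base_mem A
  tan₁ := by rw [mink_act]; simp [mink]
  tan₂ := by rw [mink_act]; simp [mink]
  unit₁ := by rw [mink_act]; simp [mink]
  unit₂ := by rw [mink_act]; simp [mink]
  orth := by rw [mink_act]; simp [mink]

/-- `SpinMove F A t B`: moving the frame continuously along the path of frames `F`, starting at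
time `0` from the spin frame `A`, one arrives at time `t` at the spin frame `B`. In other words,
the lift of `F` to spin frames that starts at `A` passes through `B` at time `t`. -/
def SpinMove (F : ℝ → Frame) (A : Spin) (t : ℝ) (B : Spin) : Prop :=
  ∃ c : ℝ → Spin, Continuous c ∧ (∀ s, Spin.frame (c s) = F s) ∧ c 0 = A ∧ c t = B

/-- `B` is obtained from the spin frame `A` by parallel translation by signed distance `s` along
the oriented geodesic in the direction of the first vector of `A`. -/
def SpinTranslate (A : Spin) (s : ℝ) (B : Spin) : Prop := SpinMove (Spin.frame A).translate A s B

/-- `B` is obtained from the spin frame `A` by rotation by angle `t` about its first vector. -/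
def SpinRotate₁ (A : Spin) (t : ℝ) (B : Spin) : Prop := SpinMove (Spin.frame A).rotate₁ A t B

/-- `B` is obtained from the spin frame `A` by rotation by angle `t` about its second vector. -/
def SpinRotate₂ (A : Spin) (t : ℝ) (B : Spin) : Prop := SpinMove (Spin.frame A).rotate₂ A t B

/-- `d = ρ + iθ` is a complex distance from the spin frame `A` to the spin frame `B`: both are
adapted to a common oriented geodesic (their first vectors are positively tangent to it), and
translation along it by signed distance `ρ` followed by rotation about it by angle `θ` takes `A`
to `B`. Such `d` is meant modulo `4πi`. -/
def IsComplexDistance (A B : Spin) (d : ℂ) : Prop :=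
  ∃ C : Spin, SpinTranslate A d.re C ∧ SpinRotate₁ C d.im B

/-! ### Horospheres -/

/-- A horosphere in the hyperboloid model: a non-empty intersection of `ℍ³` with an affine 3-plane
whose Minkowski normal is lightlike. The normal may be taken in the positive light cone. -/
structure Horosphere where
  carrier : Set Mink
  nonempty : carrier.Nonempty
  exists_plane : ∃ n ∈ lightCone, ∃ c : ℝ, carrier = {x ∈ H3 | mink x n = c}

namespace Horosphere

/-- A vector of the positive light cone on the ray that is the centre of the horosphere. Only the
ray is significant. -/
noncomputable def centre (h : Horosphere) : Mink := h.exists_plane.choose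

theorem centre_mem (h : Horosphere) : h.centre ∈ lightCone := h.exists_plane.choose_spec.1

theorem carrier_eq (h : Horosphere) : ∃ c : ℝ, h.carrier = {x ∈ H3 | mink x h.centre = c} :=
  h.exists_plane.choose_spec.2

theorem mem_H3 (h : Horosphere) (q : h.carrier) : (q : Mink) ∈ H3 := by
  obtain ⟨c, hc⟩ := h.carrier_eq
  exact (hc.subset q.2).1

end Horosphere

/-- The unit tangent vector at `q` pointing along the geodesic ray from `q` to the ideal point
given by the ray of `p`. It does not change if `p` is scaled. -/
noncomputable def towards (q p : Mink) : Mink := (mink q p)⁻¹ • p + (-1 : ℝ) • q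

theorem mink_pos {q p : Mink} (hq : q ∈ H3) (hp : p ∈ lightCone) : 0 < mink q p := by
  obtain ⟨h1, h0⟩ := hq
  obtain ⟨g1, g0⟩ := hp
  simp only [mink] at *
  have cs : (q 1 * p 1 + q 2 * p 2 + q 3 * p 3) ^ 2 ≤
      (q 1 ^ 2 + q 2 ^ 2 + q 3 ^ 2) * (p 1 ^ 2 + p 2 ^ 2 + p 3 ^ 2) := by
    nlinarith [sq_nonneg (q 1 * p 2 - q 2 * p 1), sq_nonneg (q 1 * p 3 - q 3 * p 1),
      sq_nonneg (q 2 * p 3 - q 3 * p 2)]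
  have e1 : q 1 ^ 2 + q 2 ^ 2 + q 3 ^ 2 = q 0 ^ 2 - 1 := by linarith
  have e2 : p 1 ^ 2 + p 2 ^ 2 + p 3 ^ 2 = p 0 ^ 2 := by linarith
  rw [e1, e2] at cs
  have hlt : |q 1 * p 1 + q 2 * p 2 + q 3 * p 3| < q 0 * p 0 := by
    apply abs_lt_of_sq_lt_sq _ (by positivity)
    nlinarith [pow_pos g0 2]
  have := (abs_lt.mp hlt).2
  linarith

theorem mink_towards_left {q p : Mink} (hq : q ∈ H3) (hp : p ∈ lightCone) :
    mink q (towards q p) = 0 := by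
  have h := (mink_pos hq hp).ne'
  rw [towards, mink_comb_right, hq.1]
  field_simp
  norm_num

theorem mink_towards_self {q p : Mink} (hq : q ∈ H3) (hp : p ∈ lightCone) :
    mink (towards q p) (towards q p) = -1 := by
  have h := (mink_pos hq hp).ne'
  rw [towards, mink_comb_right, mink_comb_left, mink_comb_left, hq.1, hp.1, mink_comm p q]
  field_simp
  norm_num

/-- An element of `SL(2,ℂ)` of trace `±2`. -/
def IsParabolic (A : SL(2, ℂ)) : Prop :=
  (A : Matrix (Fin 2) (Fin 2) ℂ).trace = 2 ∨ (A : Matrix (Fin 2) (Fin 2) ℂ).trace = -2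

/-- A unit parallel vector field on a horosphere: a field of unit vectors tangent to the
horosphere, invariant under the parabolic isometries that preserve the horosphere. -/
structure ParallelField (h : Horosphere) where
  V : h.carrier → Mink
  tangent : ∀ q : h.carrier, mink q (V q) = 0 ∧ mink h.centre (V q) = 0
  unit : ∀ q : h.carrier, mink (V q) (V q) = -1
  parallel : ∀ A : SL(2, ℂ), IsParabolic A → act A '' h.carrier = h.carrier →
    ∀ q q' : h.carrier, (q' : Mink) = act A q → V q' = act A (V q)

/-- The outward frame field `(N_out, V, N_out × V)`, where `N_out` is the unit normal of the
horosphere towards its centre. -/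
noncomputable def outFrame (h : Horosphere) (𝒱 : ParallelField h) (q : h.carrier) : Frame where
  pt := q
  e₁ := towards q h.centre
  e₂ := 𝒱.V q
  pt_mem := h.mem_H3 q
  tan₁ := mink_towards_left (h.mem_H3 q) h.centre_mem
  tan₂ := (𝒱.tangent q).1
  unit₁ := mink_towards_self (h.mem_H3 q) h.centre_mem
  unit₂ := 𝒱.unit q
  orth := by rw [towards, mink_comb_left, (𝒱.tangent q).1, (𝒱.tangent q).2]; ring

/-- The inward frame field `(N_in, V, N_in × V)`, where `N_in = -N_out` is the unit normal of the
horosphere pointing away from its centre. -/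
noncomputable def inFrame (h : Horosphere) (𝒱 : ParallelField h) (q : h.carrier) : Frame where
  pt := q
  e₁ := -towards q h.centre
  e₂ := 𝒱.V q
  pt_mem := h.mem_H3 q
  tan₁ := by
    have := (outFrame h 𝒱 q).tan₁
    simp only [outFrame, mink, Pi.neg_apply] at *; linarith
  tan₂ := (𝒱.tangent q).1
  unit₁ := by
    have := (outFrame h 𝒱 q).unit₁
    simp only [outFrame, mink, Pi.neg_apply] at *; linarith
  unit₂ := 𝒱.unit q
  orth := by
    have := (outFrame h 𝒱 q).orth
    simp only [outFrame, mink, Pi.neg_apply] at *; linarith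

/-- A spin-decorated horosphere: a horosphere with continuous lifts `Win`, `Wout` to spin frames of
the inward and outward frame fields of a unit parallel vector field `𝒱`, each associated to the
other: `Win` is `Wout` rotated by `π` about `𝒱`, and `Wout` is `Win` rotated by `-π` about `𝒱`. -/
structure SpinDecoratedHorosphere where
  h : Horosphere
  𝒱 : ParallelField h
  Win : h.carrier → Spin
  Wout : h.carrier → Spin
  continuous_Win : Continuous Win
  continuous_Wout : Continuous Wout
  frame_Win : ∀ q, Spin.frame (Win q) = inFrame h 𝒱 q
  frame_Wout : ∀ q, Spin.frame (Wout q) = outFrame h 𝒱 q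
  associated_in : ∀ q, SpinRotate₂ (Wout q) Real.pi (Win q)
  associated_out : ∀ q, SpinRotate₂ (Win q) (-Real.pi) (Wout q)

/-- The geodesic of `ℍ³` whose two ends are the rays of `p` and `p'`. -/
def geodesic (p p' : Mink) : Set Mink := H3 ∩ {x | ∃ a b : ℝ, x = a • p + b • p'}

/-- `z` is the complex lambda length from the spin-decorated horosphere `D₁` to `D₂`. If the
centres coincide, this means `z = 0`. Otherwise, let `q₁` and `q₂` be the points where the geodesic
between the centres meets the two horospheres; then `z = exp (d / 2)` where `d` is the complex
distance from the inward spin frame of `D₁` at `q₁` to the outward spin frame of `D₂` at `q₂`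
(both are adapted to the geodesic oriented from the first centre to the second). -/
def IsLambdaLength (D₁ D₂ : SpinDecoratedHorosphere) (z : ℂ) : Prop :=
  (SameRay ℝ D₁.h.centre D₂.h.centre ∧ z = 0) ∨
  (¬ SameRay ℝ D₁.h.centre D₂.h.centre ∧
    ∃ (q₁ : D₁.h.carrier) (q₂ : D₂.h.carrier) (d : ℂ),
      (q₁ : Mink) ∈ geodesic D₁.h.centre D₂.h.centre ∧
      (q₂ : Mink) ∈ geodesic D₁.h.centre D₂.h.centre ∧
      IsComplexDistance (D₁.Win q₁) (D₂.Wout q₂) d ∧ z = Complex.exp (d / 2))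

end SpinHoro

open scoped MatrixGroups

namespace SpinHoro

/-! A spin-decorated horosphere carries a spinor κ ∈ ℂ², and λ between two of them is det(κ, κ');
the theorem is then the Plücker relation among the 2×2 minors of a 2×4 matrix.

The spinor is the second column of an inward spin frame. It does not depend on the point: parabolics
about the centre act transitively on the horosphere and carry the frame field along, and by
uniqueness of lifts they change the spin frame by right multiplication by a lower unipotent matrix,
which preserves that column (`Win_move`, `Win_apply_one`). The rotation by π makes the first column
of the outward spin frame equal to -κ (`Wout_eq_neg_spinor`).

Translation and rotation along a geodesic lift to right multiplication by `diagExp d`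
(`isComplexDistance_iff`), so exp(d/2) is the determinant of the first column of the target and the
second column of the source, namely det(κ, κ') (`exp_half_eq_pairing`). Geometry enters once more to
show that such a d exists for distinct centres (`exists_isComplexDistance`) and that the determinant
vanishes for a common centre (`pairing_eq_zero`). -/

/-! ### The linear action of SL(2,ℂ) on Minkowski space -/

theorem toHerm_injective : Function.Injective toHerm := by
  intro p q h
  have h00 := congrFun (congrFun h 0) 0
  have h01 := congrFun (congrFun h 0) 1
  have h11 := congrFun (congrFun h 1) 1
  have r00 := congrArg Complex.re h00
  have r01 := congrArg Complex.re h01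
  have i01 := congrArg Complex.im h01
  have r11 := congrArg Complex.re h11
  simp [toHerm] at r00 r01 i01 r11
  ext i
  fin_cases i <;> simp <;> linarith

theorem act_mul (A B : SL(2, ℂ)) (p : Mink) : act (A * B) p = act A (act B p) := by
  apply toHerm_injective
  simp only [toHerm_act, Matrix.SpecialLinearGroup.coe_mul, Matrix.conjTranspose_mul,
    Matrix.mul_assoc]

theorem act_one (p : Mink) : act 1 p = p := by
  apply toHerm_injective
  simp [toHerm_act]

theorem act_inv_act (A : SL(2, ℂ)) (p : Mink) : act A⁻¹ (act A p) = p := by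
  rw [← act_mul, inv_mul_cancel, act_one]

theorem act_act_inv (A : SL(2, ℂ)) (p : Mink) : act A (act A⁻¹ p) = p := by
  rw [← act_mul, mul_inv_cancel, act_one]

theorem act_smul (A : SL(2, ℂ)) (r : ℝ) (p : Mink) : act A (r • p) = r • act A p := by
  ext i
  fin_cases i <;> simp [act, toHerm, ofHerm, Matrix.mul_apply, Fin.sum_univ_two] <;> ring

theorem act_comb (A : SL(2, ℂ)) (a b : ℝ) (p q : Mink) :
    act A (a • p + b • q) = a • act A p + b • act A q := by
  rw [act_add, act_smul, act_smul]

theorem act_apply (A : SL(2, ℂ)) (p : Mink) : act A p =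
    let S : Fin 2 → Fin 2 → ℂ := fun i j =>
      (A i 0 * ((p 0 + p 3) / 2) + A i 1 * ((p 1 - p 2 * Complex.I) / 2)) * star (A j 0) +
        (A i 0 * ((p 1 + p 2 * Complex.I) / 2) + A i 1 * ((p 0 - p 3) / 2)) * star (A j 1)
    ![(S 0 0 + S 1 1).re, 2 * (S 0 1).re, 2 * (S 0 1).im, (S 0 0 - S 1 1).re] := by
  simp [act, toHerm, ofHerm, Matrix.mul_apply, Fin.sum_univ_two]

theorem det_expand (A : SL(2, ℂ)) : A 0 0 * A 1 1 - A 0 1 * A 1 0 = 1 := by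
  have := A.det_coe
  rwa [Matrix.det_fin_two] at this

theorem Spin.frame_e₃ (A : Spin) : (Spin.frame A).e₃ = act A ![0, -1, 0, 0] := by
  have hn : Complex.normSq (A 0 0 * A 1 1 - A 0 1 * A 1 0) = 1 := by rw [det_expand]; simp
  -- Homogenisation: the cross product has degree 6 in the entries of `A` and their conjugates, the
  -- action degree 2, and |det A|² supplies the missing 4. The identity then holds for all 2×2
  -- matrices, so `ring` can close it.
  have hs : act A ![0, -1, 0, 0] =
      Complex.normSq (A 0 0 * A 1 1 - A 0 1 * A 1 0) • act A ![0, -1, 0, 0] := by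
    rw [hn, one_smul]
  rw [hs]
  clear hs hn
  simp only [Frame.e₃, Spin.frame]
  rw [cross_apply]
  simp only [act_apply]
  generalize A 0 0 = a
  generalize A 0 1 = b
  generalize A 1 0 = c
  generalize A 1 1 = d
  obtain ⟨a₁, a₂⟩ := a
  obtain ⟨b₁, b₂⟩ := b
  obtain ⟨c₁, c₂⟩ := c
  obtain ⟨d₁, d₂⟩ := d
  ext i
  fin_cases i <;> simp [Complex.normSq_apply] <;> ring

theorem toHerm_eq_of_act {C : SL(2, ℂ)} {p q : Mink} (h : act C p = q) :
    (C : Matrix (Fin 2) (Fin 2) ℂ) * toHerm p *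
      (C : Matrix (Fin 2) (Fin 2) ℂ).conjTranspose = toHerm q := by
  rw [← toHerm_act, h]

/-- The null vector (1, 0, 0, -1) is the matrix diag(0, 1), and the upper left entry of C diag(0, 1)
C* is |C₀₁|². The next lemma is the mirror image, for the opposite null direction. -/
theorem apply_zero_one_eq_zero {C : SL(2, ℂ)} {k : ℝ}
    (h : act C ![1, 0, 0, -1] = k • ![1, 0, 0, -1]) : C 0 1 = 0 := by
  have := congrFun (congrFun (toHerm_eq_of_act h) 0) 0
  simpa [toHerm, Matrix.mul_apply, Fin.sum_univ_two] using this

theorem apply_one_zero_eq_zero {C : SL(2, ℂ)} {k : ℝ}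
    (h : act C ![1, 0, 0, 1] = k • ![1, 0, 0, 1]) : C 1 0 = 0 := by
  have := congrFun (congrFun (toHerm_eq_of_act h) 1) 1
  simpa [toHerm, Matrix.mul_apply, Fin.sum_univ_two] using this

/-- The linear action of `SL(2,ℂ)` is trivial only for `±1`. -/
theorem eq_one_or_eq_neg_one_of_act {C : SL(2, ℂ)} (hT : act C ![1, 0, 0, 0] = ![1, 0, 0, 0])
    (hZ : act C ![0, 0, 0, 1] = ![0, 0, 0, 1]) (hY : act C ![0, 0, 1, 0] = ![0, 0, 1, 0]) :
    C = 1 ∨ C = -1 := by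
  have h01 : C 0 1 = 0 := by
    apply apply_zero_one_eq_zero (k := 1)
    have h := act_comb C 1 (-1) ![1, 0, 0, 0] ![0, 0, 0, 1]
    rw [hT, hZ] at h
    simpa using h
  have h10 : C 1 0 = 0 := by
    apply apply_one_zero_eq_zero (k := 1)
    have h := act_comb C 1 1 ![1, 0, 0, 0] ![0, 0, 0, 1]
    rw [hT, hZ] at h
    simpa using h
  have hd := det_expand C
  rw [h01, zero_mul, sub_zero] at hd
  -- For C = diag(a, d), fixing Y gives a·d̄ = 1 and fixing T gives d·d̄ = 1; hence a = d, and det C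
  -- = 1 leaves d = ±1.
  have hy : C 0 0 * star (C 1 1) = 1 := by
    have := congrFun (congrFun (toHerm_eq_of_act hY) 0) 1
    simp [toHerm, Matrix.mul_apply, Fin.sum_univ_two, h01] at this
    apply mul_left_cancel₀ Complex.I_ne_zero
    simp only [Complex.star_def]
    linear_combination 2 * this
  have ht : C 1 1 * star (C 1 1) = 1 := by
    have := congrFun (congrFun (toHerm_eq_of_act hT) 1) 1
    simp [toHerm, Matrix.mul_apply, Fin.sum_univ_two, h10] at this
    simp only [Complex.star_def]
    linear_combination 2 * this
  have h0 : star (C 1 1) ≠ 0 := right_ne_zero_of_mul_eq_one ht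
  have had : C 0 0 = C 1 1 := mul_right_cancel₀ h0 (hy.trans ht.symm)
  rw [had] at hd
  rcases mul_self_eq_one_iff.mp hd with h | h
  · left
    ext i j
    fin_cases i <;> fin_cases j <;> simp [h01, h10, had, h]
  · right
    ext i j
    fin_cases i <;> fin_cases j <;> simp [h01, h10, had, h]

/-! ### The double cover and uniqueness of lifts -/

theorem Spin.eq_or_eq_neg {A B : Spin} (h : Spin.frame A = Spin.frame B) : A = B ∨ A = -B := by
  have hC : B⁻¹ * A = 1 ∨ B⁻¹ * A = -1 := by
    apply eq_one_or_eq_neg_one_of_act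
    · rw [act_mul, show act A _ = act B _ from congrArg Frame.pt h, act_inv_act]
    · rw [act_mul, show act A _ = act B _ from congrArg Frame.e₁ h, act_inv_act]
    · rw [act_mul, show act A _ = act B _ from congrArg Frame.e₂ h, act_inv_act]
  rcases hC with hC | hC
  · left; exact (inv_mul_eq_one.mp hC).symm
  · right
    rw [inv_mul_eq_iff_eq_mul] at hC
    simpa using hC

theorem Spin.ne_neg (A : Spin) : A ≠ -A := by
  intro h
  have e : ∀ i j, A i j = 0 := fun i j => by
    have := congrArg (fun M : SL(2, ℂ) => M i j) h
    simpa [self_eq_neg] using this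
  have := det_expand A
  simp [e] at this

/-- Two lifts to spin frames of the same frame field on a connected space agree if they agree at
one point. -/
theorem Spin.lift_unique {X : Type*} [TopologicalSpace X] [PreconnectedSpace X] {c c' : X → Spin}
    (hc : Continuous c) (hc' : Continuous c') (h : ∀ x, Spin.frame (c x) = Spin.frame (c' x))
    {x₀ : X} (h₀ : c x₀ = c' x₀) : c = c' := by
  have : T2Space Spin := inferInstanceAs (T2Space (Subtype _))
  have hneg : Continuous fun x => -c' x :=
    Continuous.subtype_mk (continuous_subtype_val.comp hc').neg _
  -- The two sheets never meet, so disagreement is agreement with the other sheet, again a closed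
  -- condition.
  have hs : {x | c x = c' x} = {x | c x = -c' x}ᶜ := by
    ext x
    refine ⟨fun hx hx' => Spin.ne_neg (c' x) (hx.symm.trans hx'), fun hx => ?_⟩
    exact (Spin.eq_or_eq_neg (h x)).resolve_right hx
  have hclopen : IsClopen {x | c x = c' x} :=
    ⟨isClosed_eq hc hc', hs ▸ (isClosed_eq hc hneg).isOpen_compl⟩
  funext x
  exact (hclopen.eq_univ ⟨x₀, h₀⟩ ▸ Set.mem_univ x : x ∈ {x | c x = c' x})

/-- Replaces the existential over paths by an equation: one explicit lift determines the endpoint.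
-/
theorem SpinMove.iff_of_lift {F : ℝ → Frame} {c : ℝ → Spin} (hc : Continuous c)
    (hF : ∀ s, Spin.frame (c s) = F s) (t : ℝ) (B : Spin) : SpinMove F (c 0) t B ↔ B = c t := by
  constructor
  · rintro ⟨c', hc', hF', h0, rfl⟩
    rw [Spin.lift_unique hc' hc (fun s => (hF' s).trans (hF s).symm) h0]
  · rintro rfl
    exact ⟨c, hc, hF, rfl, rfl⟩

/-! ### Explicit lifts of translations and rotations -/

/-- The diagonal matrix with entries `exp (d / 2)` and `exp (-d / 2)`. -/
noncomputable def diagExp (d : ℂ) : SL(2, ℂ) :=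
  ⟨!![Complex.exp (d / 2), 0; 0, Complex.exp (-(d / 2))], by
    rw [Matrix.det_fin_two_of, ← Complex.exp_add]; simp⟩

/-- The lift to `SL(2,ℂ)` of the rotation by angle `t` about the `Y` axis. -/
noncomputable def rotY (t : ℝ) : SL(2, ℂ) :=
  ⟨!![(Real.cos (t / 2) : ℂ), -(Real.sin (t / 2) : ℂ);
      (Real.sin (t / 2) : ℂ), (Real.cos (t / 2) : ℂ)], by
    rw [Matrix.det_fin_two_of]
    have := Real.cos_sq_add_sin_sq (t / 2)
    have h : ((Real.cos (t / 2) ^ 2 + Real.sin (t / 2) ^ 2 : ℝ) : ℂ) = 1 := by rw [this]; simp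
    push_cast at h ⊢
    linear_combination h⟩

theorem continuous_diagExp : Continuous diagExp := by
  apply Continuous.subtype_mk
  refine continuous_matrix fun i j => ?_
  fin_cases i <;> fin_cases j <;> simp <;> fun_prop

theorem continuous_rotY : Continuous rotY := by
  apply Continuous.subtype_mk
  refine continuous_matrix fun i j => ?_
  fin_cases i <;> fin_cases j <;> simp <;> fun_prop

theorem diagExp_zero : diagExp 0 = 1 := by
  ext i j; fin_cases i <;> fin_cases j <;> simp [diagExp]

theorem rotY_zero : rotY 0 = 1 := by
  ext i j; fin_cases i <;> fin_cases j <;> simp [rotY]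

theorem diagExp_add (d d' : ℂ) : diagExp (d + d') = diagExp d * diagExp d' := by
  apply Subtype.ext
  rw [Matrix.SpecialLinearGroup.coe_mul]
  simp only [diagExp, Matrix.mul_fin_two, add_div, neg_add, Complex.exp_add]
  simp

theorem toHerm_act_diagExp (d : ℂ) (p : Mink) : toHerm (act (diagExp d) p) =
    !![Complex.exp d.re * ((p 0 + p 3) / 2),
       Complex.exp (d.im * Complex.I) * ((p 1 + p 2 * Complex.I) / 2);
       Complex.exp (-(d.im * Complex.I)) * ((p 1 - p 2 * Complex.I) / 2),
       Complex.exp (-d.re) * ((p 0 - p 3) / 2)] := by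
  have h1 : d = d.re + d.im * Complex.I := (Complex.re_add_im d).symm
  have h2 : starRingEnd ℂ d = d.re - d.im * Complex.I := by
    apply Complex.ext <;> simp
  have e1 : Complex.exp d.re = Complex.exp (d / 2) * Complex.exp (starRingEnd ℂ d / 2) := by
    rw [← Complex.exp_add]; congr 1; rw [h2]; linear_combination (-1 / 2) * h1
  have e2 : Complex.exp (d.im * Complex.I) =
      Complex.exp (d / 2) * Complex.exp (-(starRingEnd ℂ d / 2)) := by
    rw [← Complex.exp_add]; congr 1; rw [h2]; linear_combination (-1 / 2) * h1
  have e3 : Complex.exp (-(d.im * Complex.I)) =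
      Complex.exp (-(d / 2)) * Complex.exp (starRingEnd ℂ d / 2) := by
    rw [← Complex.exp_add]; congr 1; rw [h2]; linear_combination (1 / 2) * h1
  have e4 : Complex.exp (-d.re) = Complex.exp (-(d / 2)) * Complex.exp (-(starRingEnd ℂ d / 2)) := by
    rw [← Complex.exp_add]; congr 1; rw [h2]; linear_combination (1 / 2) * h1
  have c2 : starRingEnd ℂ 2 = 2 := map_ofNat _ 2
  rw [toHerm_act, e1, e2, e3, e4]
  ext i j
  fin_cases i <;> fin_cases j <;>
    simp [diagExp, toHerm, Matrix.mul_apply, Fin.sum_univ_two, ← Complex.exp_conj, c2] <;> ring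

/-- A right factor moves the base frame before `A` is applied, and `A` acts linearly, so only the
base vectors T, Z, Y need computing. -/
theorem frame_mul_diagExp_ofReal (A : Spin) (s : ℝ) :
    Spin.frame (A * diagExp s) = (Spin.frame A).translate s := by
  have hT : act (diagExp s) ![1, 0, 0, 0] =
      Real.cosh s • ![1, 0, 0, 0] + Real.sinh s • ![0, 0, 0, 1] := by
    apply toHerm_injective
    rw [toHerm_act_diagExp]
    ext i j
    fin_cases i <;> fin_cases j <;> simp [toHerm]
    · ring
    · ring
  have hZ : act (diagExp s) ![0, 0, 0, 1] =
      Real.sinh s • ![1, 0, 0, 0] + Real.cosh s • ![0, 0, 0, 1] := by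
    apply toHerm_injective
    rw [toHerm_act_diagExp]
    ext i j
    fin_cases i <;> fin_cases j <;> simp [toHerm]
    · ring
    · ring
  have hY : act (diagExp s) ![0, 0, 1, 0] = ![0, 0, 1, 0] := by
    apply toHerm_injective
    rw [toHerm_act_diagExp]
    ext i j
    fin_cases i <;> fin_cases j <;> simp [toHerm]
  apply Frame.ext
  · simp only [Spin.frame, Frame.translate, act_mul, hT, act_comb]
  · simp only [Spin.frame, Frame.translate, act_mul, hZ, act_comb]
  · simp only [Spin.frame, Frame.translate, act_mul, hY]

theorem frame_mul_diagExp_I (A : Spin) (t : ℝ) :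
    Spin.frame (A * diagExp (t * Complex.I)) = (Spin.frame A).rotate₁ t := by
  have hc : Complex.exp (t * Complex.I) = Real.cos t + Real.sin t * Complex.I := by
    push_cast; rw [Complex.exp_mul_I]
  have hs : Complex.exp (-(t * Complex.I)) = Real.cos t - Real.sin t * Complex.I := by
    push_cast; rw [← neg_mul, Complex.exp_mul_I]; simp; ring
  have hT : act (diagExp (t * Complex.I)) ![1, 0, 0, 0] = ![1, 0, 0, 0] := by
    apply toHerm_injective
    rw [toHerm_act_diagExp]
    ext i j
    fin_cases i <;> fin_cases j <;> simp [toHerm]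
  have hZ : act (diagExp (t * Complex.I)) ![0, 0, 0, 1] = ![0, 0, 0, 1] := by
    apply toHerm_injective
    rw [toHerm_act_diagExp]
    ext i j
    fin_cases i <;> fin_cases j <;> simp [toHerm]
  -- Y turns towards -X, the third vector of the base frame.
  have hY : act (diagExp (t * Complex.I)) ![0, 0, 1, 0] =
      Real.cos t • ![0, 0, 1, 0] + Real.sin t • ![0, -1, 0, 0] := by
    apply toHerm_injective
    rw [toHerm_act_diagExp]
    ext i j
    fin_cases i <;> fin_cases j <;> simp [toHerm, hc, hs]
    · linear_combination (Complex.sin t / 2) * Complex.I_sq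
    · linear_combination (Complex.sin t / 2) * Complex.I_sq
  apply Frame.ext
  · simp only [Spin.frame, Frame.rotate₁, act_mul, hT]
  · simp only [Spin.frame, Frame.rotate₁, act_mul, hZ]
  · simp only [Frame.rotate₁, Spin.frame_e₃]
    simp only [Spin.frame, act_mul, hY, act_comb]

theorem frame_mul_rotY (A : Spin) (t : ℝ) :
    Spin.frame (A * rotY t) = (Spin.frame A).rotate₂ t := by
  have h1 : Complex.cos (t / 2) ^ 2 + Complex.sin (t / 2) ^ 2 = 1 := Complex.cos_sq_add_sin_sq _
  have hc : Complex.cos t = Complex.cos (t / 2) ^ 2 - Complex.sin (t / 2) ^ 2 := by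
    rw [show (t : ℂ) = 2 * (t / 2) by ring, Complex.cos_two_mul,
      show (2 * (t / 2 : ℂ) / 2) = t / 2 by ring]
    linear_combination h1
  have hs : Complex.sin t = 2 * Complex.sin (t / 2) * Complex.cos (t / 2) := by
    rw [← Complex.sin_two_mul]; ring_nf
  have e1 := Complex.cos_conj (t / 2)
  have e2 := Complex.sin_conj (t / 2)
  have c2 : starRingEnd ℂ 2 = 2 := map_ofNat _ 2
  simp [c2] at e1 e2
  have hT : act (rotY t) ![1, 0, 0, 0] = ![1, 0, 0, 0] := by
    apply toHerm_injective
    rw [toHerm_act]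
    ext i j
    fin_cases i <;> fin_cases j <;>
      simp [toHerm, rotY, Matrix.mul_apply, Fin.sum_univ_two, ← e1, ← e2]
    · linear_combination h1 / 2
    · ring
    · ring
    · linear_combination h1 / 2
  have hY : act (rotY t) ![0, 0, 1, 0] = ![0, 0, 1, 0] := by
    apply toHerm_injective
    rw [toHerm_act]
    ext i j
    fin_cases i <;> fin_cases j <;>
      simp [toHerm, rotY, Matrix.mul_apply, Fin.sum_univ_two, ← e1, ← e2]
    · ring
    · linear_combination (Complex.I / 2) * h1
    · linear_combination (-Complex.I / 2) * h1
    · ring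
  have hZ : act (rotY t) ![0, 0, 0, 1] =
      Real.cos t • ![0, 0, 0, 1] + (-Real.sin t) • ![0, -1, 0, 0] := by
    apply toHerm_injective
    rw [toHerm_act]
    ext i j
    fin_cases i <;> fin_cases j <;>
      simp [toHerm, rotY, Matrix.mul_apply, Fin.sum_univ_two, ← e1, ← e2, hc, hs] <;> ring
  apply Frame.ext
  · simp only [Spin.frame, Frame.rotate₂, act_mul, hT]
  · simp only [Frame.rotate₂, Spin.frame_e₃]
    simp only [Spin.frame, act_mul, hZ, act_comb]
  · simp only [Spin.frame, Frame.rotate₂, act_mul, hY]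

theorem spinTranslate_iff {A B : Spin} {s : ℝ} : SpinTranslate A s B ↔ B = A * diagExp s := by
  have := SpinMove.iff_of_lift (c := fun s : ℝ => A * diagExp s)
    (continuous_const.mul (continuous_diagExp.comp Complex.continuous_ofReal))
    (frame_mul_diagExp_ofReal A) s B
  simpa [diagExp_zero, SpinTranslate] using this

theorem spinRotate₁_iff {A B : Spin} {t : ℝ} :
    SpinRotate₁ A t B ↔ B = A * diagExp (t * Complex.I) := by
  have := SpinMove.iff_of_lift (c := fun t : ℝ => A * diagExp (t * Complex.I))
    (continuous_const.mul (continuous_diagExp.comp (by fun_prop)))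
    (frame_mul_diagExp_I A) t B
  simpa [diagExp_zero, SpinRotate₁] using this

theorem spinRotate₂_iff {A B : Spin} {t : ℝ} : SpinRotate₂ A t B ↔ B = A * rotY t := by
  have := SpinMove.iff_of_lift (c := fun t : ℝ => A * rotY t)
    (continuous_const.mul continuous_rotY) (frame_mul_rotY A) t B
  simpa [rotY_zero, SpinRotate₂] using this

theorem isComplexDistance_iff {A B : Spin} {d : ℂ} :
    IsComplexDistance A B d ↔ B = A * diagExp d := by
  simp only [IsComplexDistance, spinTranslate_iff, spinRotate₁_iff, exists_eq_left, mul_assoc,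
    ← diagExp_add, Complex.re_add_im]

/-! ### Parabolics and the standard horosphere -/

/-- The parabolic matrix `(1, 0; s, 1)`. -/
noncomputable def lowerUnip (s : ℂ) : SL(2, ℂ) :=
  ⟨!![1, 0; s, 1], by rw [Matrix.det_fin_two_of]; ring⟩

theorem continuous_lowerUnip : Continuous lowerUnip := by
  apply Continuous.subtype_mk
  refine continuous_matrix fun i j => ?_
  fin_cases i <;> fin_cases j <;> simp <;> fun_prop

theorem lowerUnip_zero : lowerUnip 0 = 1 := by
  ext i j; fin_cases i <;> fin_cases j <;> simp [lowerUnip]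

theorem act_lowerUnip_null (s : ℂ) : act (lowerUnip s) ![1, 0, 0, -1] = ![1, 0, 0, -1] := by
  apply toHerm_injective
  rw [toHerm_act]
  ext i j
  fin_cases i <;> fin_cases j <;>
    simp [toHerm, lowerUnip, Matrix.mul_apply, Fin.sum_univ_two]

/-- The image of the base point is ½(1, s̄; s, 1 + |s|²), so s is read off the lower left entry; the
last entry is then forced by the two hypotheses. -/
theorem act_lowerUnip_base {x : Mink} (hx : mink x x = 1) (hn : mink x ![1, 0, 0, -1] = 1) :
    act (lowerUnip (x 1 - x 2 * Complex.I)) ![1, 0, 0, 0] = x := by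
  have hn' : x 0 + x 3 = 1 := by simpa [mink] using hn
  have hx' : x 0 - x 3 = 1 + x 1 ^ 2 + x 2 ^ 2 := by
    simp only [mink] at hx
    linear_combination hx - (x 0 - x 3) * hn'
  have h1 : (x 0 + x 3 : ℂ) = 1 := by exact_mod_cast hn'
  have h2 : (x 0 - x 3 : ℂ) = 1 + x 1 ^ 2 + x 2 ^ 2 := by exact_mod_cast hx'
  apply toHerm_injective
  rw [toHerm_act]
  ext i j
  fin_cases i <;> fin_cases j <;>
    simp [toHerm, lowerUnip, Matrix.mul_apply, Fin.sum_univ_two]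
  · linear_combination (-1 / 2) * h1
  · ring
  · ring
  · linear_combination (-1 / 2) * h2 - (x 2 ^ 2 / 2) * Complex.I_sq

theorem continuous_act {X : Type*} [TopologicalSpace X] {c : X → SL(2, ℂ)} (hc : Continuous c)
    (p : Mink) : Continuous fun x => act (c x) p := by
  have hM : Continuous fun x => (c x : Matrix (Fin 2) (Fin 2) ℂ) := continuous_subtype_val.comp hc
  have hS := (hM.matrix_mul (continuous_const (y := toHerm p))).matrix_mul hM.matrix_conjTranspose
  have he := fun i j => hS.matrix_elem i j
  refine continuous_pi fun i => ?_
  fin_cases i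
  · exact Complex.continuous_re.comp ((he 0 0).add (he 1 1))
  · exact continuous_const.mul (Complex.continuous_re.comp (he 0 1))
  · exact continuous_const.mul (Complex.continuous_im.comp (he 0 1))
  · exact Complex.continuous_re.comp ((he 0 0).sub (he 1 1))

theorem act_sub_null (A : SL(2, ℂ)) : act A ![1, 0, 0, -1] =
    act A ![1, 0, 0, 0] + (-1 : ℝ) • act A ![0, 0, 0, 1] := by
  rw [← act_smul, ← act_add]; congr 1; simp

theorem act_add_null (A : SL(2, ℂ)) : act A ![1, 0, 0, 1] =
    act A ![1, 0, 0, 0] + act A ![0, 0, 0, 1] := by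
  rw [← act_add]; congr 1; simp

theorem mink_smul_right (r : ℝ) (p q : Mink) : mink p (r • q) = r * mink p q := by
  simp [mink]; ring

/-- On the lower sheet, `-y` would lie in `H3` and pair positively with `p`. -/
theorem mem_H3_of_mink_pos {y p : Mink} (hy : mink y y = 1) (hp : p ∈ lightCone)
    (h : 0 < mink y p) : y ∈ H3 := by
  refine ⟨hy, ?_⟩
  by_contra! h0
  rcases h0.lt_or_eq with h0 | h0
  · have : 0 < mink (-y) p := mink_pos ⟨by simpa [mink] using hy, by simpa using h0⟩ hp
    simp only [mink, Pi.neg_apply] at this h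
    linarith
  · simp only [mink, h0] at hy
    nlinarith [sq_nonneg (y 1), sq_nonneg (y 2), sq_nonneg (y 3)]

theorem act_neg_towards {P : SL(2, ℂ)} {p : Mink} (hP : act P p = p) (q : Mink) :
    act P (-towards q p) = -towards (act P q) p := by
  have hm : mink (act P q) p = mink q p := by
    conv_lhs => rw [← hP]
    exact mink_act P q p
  have h1 : ∀ q : Mink, -towards q p = (-(mink q p)⁻¹) • p + (1 : ℝ) • q := fun q => by
    rw [towards]; module
  rw [h1, h1, act_comb, hP, hm]

/-! ### Horospheres and their stabilising parabolics -/

namespace Horosphere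

variable (h : Horosphere)

theorem mink_centre_eq (q q' : h.carrier) : mink q h.centre = mink q' h.centre := by
  obtain ⟨c, hc⟩ := h.carrier_eq
  exact (hc.subset q.2).2.trans (hc.subset q'.2).2.symm

theorem mink_centre_pos (q : h.carrier) : 0 < mink q h.centre := mink_pos (h.mem_H3 q) h.centre_mem

theorem mem_carrier {x : Mink} (q : h.carrier) (hx : mink x x = 1)
    (hq : mink x h.centre = mink q h.centre) : x ∈ h.carrier := by
  obtain ⟨c, hc⟩ := h.carrier_eq
  rw [hc]
  exact ⟨mem_H3_of_mink_pos hx h.centre_mem (hq ▸ h.mink_centre_pos q),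
    hq.trans (hc.subset q.2).2⟩

theorem act_mem_carrier {P : SL(2, ℂ)} (hP : act P h.centre = h.centre) (q : h.carrier) :
    act P q ∈ h.carrier := by
  apply h.mem_carrier q
  · rw [mink_act, (h.mem_H3 q).1]
  · conv_lhs => rw [← hP]
    exact mink_act P q h.centre

theorem act_image_carrier {P : SL(2, ℂ)} (hP : act P h.centre = h.centre) :
    act P '' h.carrier = h.carrier := by
  apply subset_antisymm
  · rintro _ ⟨q, hq, rfl⟩
    exact h.act_mem_carrier hP ⟨q, hq⟩
  · intro q hq
    have hP' : act P⁻¹ h.centre = h.centre := by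
      conv_lhs => rw [← hP]
      exact act_inv_act P _
    exact ⟨act P⁻¹ q, h.act_mem_carrier hP' ⟨q, hq⟩, act_act_inv P q⟩

end Horosphere

/-! ### The spinor of a spin-decorated horosphere -/

namespace SpinDecoratedHorosphere

variable (D : SpinDecoratedHorosphere)

theorem act_Win_base (q : D.h.carrier) : act (D.Win q) ![1, 0, 0, 0] = q :=
  congrArg Frame.pt (D.frame_Win q)

theorem act_Win_fst (q : D.h.carrier) :
    act (D.Win q) ![0, 0, 0, 1] = -towards q D.h.centre :=
  congrArg Frame.e₁ (D.frame_Win q)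

theorem act_Win_snd (q : D.h.carrier) : act (D.Win q) ![0, 0, 1, 0] = D.𝒱.V q :=
  congrArg Frame.e₂ (D.frame_Win q)

theorem act_Wout_base (q : D.h.carrier) : act (D.Wout q) ![1, 0, 0, 0] = q :=
  congrArg Frame.pt (D.frame_Wout q)

theorem act_Wout_fst (q : D.h.carrier) :
    act (D.Wout q) ![0, 0, 0, 1] = towards q D.h.centre :=
  congrArg Frame.e₁ (D.frame_Wout q)

/-- The inward normal points away from the centre, so the backward null vector of the inward frame
lies on the ray of the centre. -/
theorem act_Win_backward (q : D.h.carrier) :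
    act (D.Win q) ![1, 0, 0, -1] = (mink q D.h.centre)⁻¹ • D.h.centre := by
  rw [act_sub_null, act_Win_base, act_Win_fst, towards]; module

theorem act_Win_forward (q : D.h.carrier) :
    act (D.Win q) ![1, 0, 0, 1] = (2 : ℝ) • (q : Mink) - (mink q D.h.centre)⁻¹ • D.h.centre := by
  rw [act_add_null, act_Win_base, act_Win_fst, towards]; module

theorem act_Wout_backward (q : D.h.carrier) :
    act (D.Wout q) ![1, 0, 0, -1] = (2 : ℝ) • (q : Mink) - (mink q D.h.centre)⁻¹ • D.h.centre := by
  rw [act_sub_null, act_Wout_base, act_Wout_fst, towards]; module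

theorem act_Wout_forward (q : D.h.carrier) :
    act (D.Wout q) ![1, 0, 0, 1] = (mink q D.h.centre)⁻¹ • D.h.centre := by
  rw [act_add_null, act_Wout_base, act_Wout_fst, towards]; module

theorem centre_eq (q : D.h.carrier) :
    D.h.centre = mink q D.h.centre • act (D.Win q) ![1, 0, 0, -1] := by
  rw [act_Win_backward, smul_inv_smul₀ (D.h.mink_centre_pos q).ne']

/-- The parabolic isometry `Win q * lowerUnip s * (Win q)⁻¹` fixes the centre. -/
theorem act_conj_centre (q : D.h.carrier) (s : ℂ) :
    act (D.Win q * lowerUnip s * (D.Win q)⁻¹) D.h.centre = D.h.centre := by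
  rw [D.centre_eq q, act_smul, act_mul, act_inv_act, act_mul, act_lowerUnip_null]

/-- The point of the horosphere to which a parabolic isometry moves a given point. -/
noncomputable def move (q : D.h.carrier) (s : ℂ) : D.h.carrier :=
  ⟨act (D.Win q * lowerUnip s * (D.Win q)⁻¹) q, D.h.act_mem_carrier (D.act_conj_centre q s) q⟩

theorem continuous_move (q : D.h.carrier) : Continuous (D.move q) :=
  Continuous.subtype_mk (continuous_act
    ((continuous_const.mul continuous_lowerUnip).mul continuous_const) _) _

theorem move_zero (q : D.h.carrier) : D.move q 0 = q := by
  apply Subtype.ext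
  simp only [move, lowerUnip_zero, mul_one, mul_inv_cancel, act_one]

/-- Pulling back by `D.Win q` sends the horosphere to the standard one through the base point, where
`act_lowerUnip_base` gives the parameter. -/
theorem exists_move_eq (q q' : D.h.carrier) : ∃ s, D.move q s = q' := by
  set x := act (D.Win q)⁻¹ q' with hx
  have hx' : act (D.Win q) x = q' := act_act_inv _ _
  refine ⟨x 1 - x 2 * Complex.I, Subtype.ext ?_⟩
  have hb : act (D.Win q)⁻¹ q = ![1, 0, 0, 0] := by
    conv_lhs => rw [← D.act_Win_base q]
    exact act_inv_act _ _
  simp only [move]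
  rw [act_mul, hb, act_mul, act_lowerUnip_base, hx']
  · rw [hx, mink_act, (D.h.mem_H3 q').1]
  · rw [← mink_act (D.Win q), hx', act_Win_backward, mink_smul_right,
      D.h.mink_centre_eq q' q, inv_mul_cancel₀ (D.h.mink_centre_pos q).ne']

/-- The conjugate P of `lowerUnip s` has trace 2 and fixes the centre, so it preserves the
horosphere, its normals and, by parallelism, `𝒱`. -/
theorem frame_Win_move (q : D.h.carrier) (s : ℂ) :
    Spin.frame (D.Win (D.move q s)) = Spin.frame (D.Win q * lowerUnip s) := by
  set P := D.Win q * lowerUnip s * (D.Win q)⁻¹ with hP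
  have hPc : act P D.h.centre = D.h.centre := D.act_conj_centre q s
  have hPA : D.Win q * lowerUnip s = P * D.Win q := by rw [hP]; group
  have hpar : IsParabolic P := by
    left
    rw [hP, Matrix.SpecialLinearGroup.coe_mul, Matrix.trace_mul_comm,
      ← Matrix.SpecialLinearGroup.coe_mul, ← mul_assoc, inv_mul_cancel, one_mul]
    simp [lowerUnip, Matrix.trace_fin_two]
    norm_num
  rw [hPA]
  apply Frame.ext
  · refine (D.act_Win_base _).trans ?_
    change _ = act (P * D.Win q) _
    rw [act_mul, act_Win_base]; rfl
  · refine (D.act_Win_fst _).trans ?_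
    change _ = act (P * D.Win q) _
    rw [act_mul, act_Win_fst, act_neg_towards hPc]; rfl
  · refine (D.act_Win_snd _).trans ?_
    change _ = act (P * D.Win q) _
    rw [act_mul, act_Win_snd]
    exact D.𝒱.parallel P hpar (D.h.act_image_carrier hPc) q _ rfl

/-- Both sides lift the same frame field over the connected parameter plane ℂ and agree at s = 0, so
no sign can appear. -/
theorem Win_move (q : D.h.carrier) (s : ℂ) : D.Win (D.move q s) = D.Win q * lowerUnip s :=
  congrFun (Spin.lift_unique (D.continuous_Win.comp (D.continuous_move q))
    (continuous_const.mul continuous_lowerUnip) (D.frame_Win_move q)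
    (x₀ := 0) (by simp [move_zero, lowerUnip_zero])) s

/-- The second column of the inward spin frame is constant along the horosphere. -/
theorem Win_apply_one (q q' : D.h.carrier) (i : Fin 2) : D.Win q i 1 = D.Win q' i 1 := by
  obtain ⟨s, rfl⟩ := D.exists_move_eq q' q
  rw [Win_move, Matrix.SpecialLinearGroup.coe_mul]
  simp [lowerUnip, Matrix.mul_apply, Fin.sum_univ_two]

/-- The spinor of a spin-decorated horosphere: the second column of its inward spin frames. -/
noncomputable def spinor (i : Fin 2) : ℂ := D.Win ⟨_, D.h.nonempty.some_mem⟩ i 1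

theorem Win_eq_spinor (q : D.h.carrier) (i : Fin 2) : D.Win q i 1 = D.spinor i :=
  D.Win_apply_one _ _ i

/-- Right multiplication by `rotY π` = (0, -1; 1, 0) makes the second column of `Win` minus the
first column of `Wout`. -/
theorem Wout_eq_neg_spinor (q : D.h.carrier) (i : Fin 2) : D.Wout q i 0 = -D.spinor i := by
  have h := spinRotate₂_iff.mp (D.associated_in q)
  rw [← D.Win_eq_spinor q, h, Matrix.SpecialLinearGroup.coe_mul]
  simp [rotY, Matrix.mul_apply, Fin.sum_univ_two]

end SpinDecoratedHorosphere

/-! ### Geodesics between distinct centres -/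

/-- The vector p₀p' - p'₀p has no time component, so minus its Minkowski square is a sum of squares;
nullity leaves only the cross term. -/
theorem mink_difference_self {p p' : Mink} (hp : p ∈ lightCone) (hp' : p' ∈ lightCone) :
    (p 0 * p' 1 - p' 0 * p 1) ^ 2 + (p 0 * p' 2 - p' 0 * p 2) ^ 2 +
      (p 0 * p' 3 - p' 0 * p 3) ^ 2 = 2 * p 0 * p' 0 * mink p p' := by
  have h := hp.1
  have h' := hp'.1
  simp only [mink] at *
  linear_combination -(p 0 ^ 2) * h' - p' 0 ^ 2 * h

/-- Two vectors of the positive light cone on different rays have positive product. -/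
theorem mink_pos_of_not_sameRay {p p' : Mink} (hp : p ∈ lightCone) (hp' : p' ∈ lightCone)
    (h : ¬ SameRay ℝ p p') : 0 < mink p p' := by
  have hd := mink_difference_self hp hp'
  have h0 : 0 < 2 * p 0 * p' 0 := mul_pos (mul_pos two_pos hp.2) hp'.2
  by_contra! hle
  have hle' := mul_nonpos_of_nonneg_of_nonpos h0.le hle
  have s1 := sq_nonneg (p 0 * p' 1 - p' 0 * p 1)
  have s2 := sq_nonneg (p 0 * p' 2 - p' 0 * p 2)
  have s3 := sq_nonneg (p 0 * p' 3 - p' 0 * p 3)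
  have e1 : p 0 * p' 1 - p' 0 * p 1 = 0 := pow_eq_zero_iff two_ne_zero |>.mp (by linarith)
  have e2 : p 0 * p' 2 - p' 0 * p 2 = 0 := pow_eq_zero_iff two_ne_zero |>.mp (by linarith)
  have e3 : p 0 * p' 3 - p' 0 * p 3 = 0 := pow_eq_zero_iff two_ne_zero |>.mp (by linarith)
  refine h (Or.inr (Or.inr ⟨p' 0, p 0, hp'.2, hp.2, ?_⟩))
  ext i
  fin_cases i <;> simp <;> linarith

/-- The geodesic from the centre of a horosphere to another ideal point meets the horosphere. -/
theorem Horosphere.exists_mem_geodesic (h : Horosphere) {p : Mink} (hp : p ∈ lightCone)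
    (hm : 0 < mink h.centre p) :
    ∃ q : h.carrier, (q : Mink) = (2 * mink q h.centre)⁻¹ • h.centre +
      (mink q h.centre / mink h.centre p) • p := by
  obtain ⟨q₀, hq₀⟩ := h.nonempty
  set c := mink q₀ h.centre with hc
  have hc0 : 0 < c := h.mink_centre_pos ⟨q₀, hq₀⟩
  -- For x = a n + b p with n the centre, ⟨x, n⟩ = c forces b = c/⟨n, p⟩, and then ⟨x, x⟩ = 2ac = 1
  -- forces a = 1/(2c).
  have hx : mink ((2 * c)⁻¹ • h.centre + (c / mink h.centre p) • p) h.centre = c := by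
    rw [mink_comb_left, h.centre_mem.1, mink_comm p]
    field_simp
    ring
  refine ⟨⟨(2 * c)⁻¹ • h.centre + (c / mink h.centre p) • p,
    h.mem_carrier ⟨q₀, hq₀⟩ ?_ hx⟩, ?_⟩
  · rw [mink_comb_right, hx, mink_comb_left, hp.1]
    field_simp
    ring
  · simp only [hx]

theorem inv_mul_apply_zero_one (A B : SL(2, ℂ)) :
    (A⁻¹ * B) 0 1 = A 1 1 * B 0 1 - A 0 1 * B 1 1 := by
  rw [Matrix.SpecialLinearGroup.coe_mul, Matrix.SpecialLinearGroup.coe_inv,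
    Matrix.adjugate_fin_two]
  simp [Matrix.mul_apply, Fin.sum_univ_two]
  ring

theorem eq_diagExp {C : SL(2, ℂ)} (h01 : C 0 1 = 0) (h10 : C 1 0 = 0) : ∃ d, C = diagExp d := by
  have hd := det_expand C
  rw [h01, zero_mul, sub_zero] at hd
  have h0 : C 0 0 ≠ 0 := left_ne_zero_of_mul_eq_one hd
  have h1 : C 1 1 = (C 0 0)⁻¹ := eq_inv_of_mul_eq_one_right hd
  refine ⟨2 * Complex.log (C 0 0), ?_⟩
  have h2 : 2 * Complex.log (C 0 0) / 2 = Complex.log (C 0 0) := by ring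
  ext i j
  fin_cases i <;> fin_cases j <;> simp [diagExp, h01, h10, h1, Complex.exp_neg, Complex.exp_log h0]

/-- The first column of `B` is exp(d/2) times that of `A`; take its determinant with the second
column of `A` and use det A = 1. -/
theorem exp_half_eq {A B : Spin} {d : ℂ} (h : B = A * diagExp d) :
    Complex.exp (d / 2) = B 0 0 * A 1 1 - B 1 0 * A 0 1 := by
  have h0 : ∀ i, B i 0 = A i 0 * Complex.exp (d / 2) := fun i => by
    rw [h, Matrix.SpecialLinearGroup.coe_mul]
    simp [diagExp, Matrix.mul_apply, Fin.sum_univ_two]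
  rw [h0, h0]
  linear_combination -Complex.exp (d / 2) * det_expand A

/-! ### Lambda lengths as symplectic products of spinors -/

namespace SpinDecoratedHorosphere

variable (D D' : SpinDecoratedHorosphere)

/-- The symplectic product of the spinors of two spin-decorated horospheres. -/
noncomputable def pairing : ℂ := D.spinor 0 * D'.spinor 1 - D.spinor 1 * D'.spinor 0

variable {D D'}

/-- The two inward frames share their backward null ray, so the transition matrix preserves it; its
vanishing (0, 1) entry is minus the pairing. -/
theorem pairing_eq_zero (h : SameRay ℝ D.h.centre D'.h.centre) : pairing D D' = 0 := by
  obtain ⟨q, hq⟩ := D.h.nonempty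
  obtain ⟨q', hq'⟩ := D'.h.nonempty
  have h0 : D.h.centre ≠ 0 := fun h => by simpa [h] using D.h.centre_mem.2
  have h0' : D'.h.centre ≠ 0 := fun h => by simpa [h] using D'.h.centre_mem.2
  obtain ⟨r, -, hr⟩ := h.exists_pos_left h0 h0'
  have hC : ((D.Win ⟨q, hq⟩)⁻¹ * D'.Win ⟨q', hq'⟩) 0 1 = 0 := by
    refine apply_zero_one_eq_zero (k := (mink q' D'.h.centre)⁻¹ * r * mink q D.h.centre) ?_
    rw [act_mul, act_Win_backward, act_smul]
    have e : D'.h.centre = (r * mink q D.h.centre) • act (D.Win ⟨q, hq⟩) ![1, 0, 0, -1] := by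
      rw [← hr, mul_smul, ← D.centre_eq ⟨q, hq⟩]
    have e' := congrArg (act (D.Win ⟨q, hq⟩)⁻¹) e
    rw [act_smul, act_inv_act] at e'
    rw [e', smul_smul, mul_assoc]
  rw [inv_mul_apply_zero_one] at hC
  simp only [Win_eq_spinor] at hC
  rw [pairing]
  linear_combination -hC

theorem exists_isComplexDistance (h : ¬ SameRay ℝ D.h.centre D'.h.centre) :
    ∃ (q : D.h.carrier) (q' : D'.h.carrier) (d : ℂ),
      (q : Mink) ∈ geodesic D.h.centre D'.h.centre ∧
      (q' : Mink) ∈ geodesic D.h.centre D'.h.centre ∧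
      IsComplexDistance (D.Win q) (D'.Wout q') d := by
  have hm := mink_pos_of_not_sameRay D.h.centre_mem D'.h.centre_mem h
  have hm' : 0 < mink D'.h.centre D.h.centre := mink_comm _ _ ▸ hm
  obtain ⟨q, hq⟩ := D.h.exists_mem_geodesic D'.h.centre_mem hm
  obtain ⟨q', hq'⟩ := D'.h.exists_mem_geodesic D.h.centre_mem hm'
  have hc := D.h.mink_centre_pos q
  have hc' := D'.h.mink_centre_pos q'
  have hforward := D.act_Win_forward q
  have hbackward := D.act_Win_backward q
  have hforward' := D'.act_Wout_forward q'
  have hbackward' := D'.act_Wout_backward q'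
  have hmem := D.h.mem_H3 q
  have hmem' := D'.h.mem_H3 q'
  set c := mink q D.h.centre
  set c' := mink q' D'.h.centre
  set m := mink D.h.centre D'.h.centre
  set m' := mink D'.h.centre D.h.centre
  -- At `q` and `q'` the two frames have the same forward and the same backward null rays, those of
  -- the centres of `D'` and `D`. The transition matrix preserves both, hence is diagonal.
  have h10 : ((D.Win q)⁻¹ * D'.Wout q') 1 0 = 0 := by
    refine apply_one_zero_eq_zero (k := c'⁻¹ * (m / (2 * c))) ?_
    have e : D'.h.centre = (m / (2 * c)) • act (D.Win q) ![1, 0, 0, 1] := by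
      rw [hforward]
      conv_rhs => rw [hq]
      match_scalars <;> field_simp
      all_goals ring
    rw [act_mul, hforward', act_smul, e, act_smul, act_inv_act, smul_smul]
  have h01 : ((D.Win q)⁻¹ * D'.Wout q') 0 1 = 0 := by
    refine apply_zero_one_eq_zero (k := 2 * (c' / m') * c) ?_
    have e : act (D'.Wout q') ![1, 0, 0, -1] = (2 * (c' / m')) • D.h.centre := by
      rw [hbackward', hq']
      match_scalars <;> field_simp
      all_goals ring
    rw [act_mul, e, D.centre_eq q, act_smul, act_smul, act_inv_act, smul_smul]
  obtain ⟨d, hd⟩ := eq_diagExp h01 h10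
  refine ⟨q, q', d, ⟨hmem, _, _, hq⟩, ⟨hmem', _, _, hq'.trans (add_comm _ _)⟩, ?_⟩
  rw [isComplexDistance_iff, ← hd, mul_inv_cancel_left]

theorem exp_half_eq_pairing {q : D.h.carrier} {q' : D'.h.carrier} {d : ℂ}
    (h : IsComplexDistance (D.Win q) (D'.Wout q') d) : Complex.exp (d / 2) = pairing D D' := by
  rw [exp_half_eq (isComplexDistance_iff.mp h)]
  simp only [Win_eq_spinor, Wout_eq_neg_spinor, pairing]
  ring

/-- Well-definedness: every admissible choice of `q`, `q'` and `d` gives the same exponential. -/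
theorem isLambdaLength_iff {z : ℂ} : IsLambdaLength D D' z ↔ z = pairing D D' := by
  by_cases h : SameRay ℝ D.h.centre D'.h.centre
  · simp [IsLambdaLength, h, pairing_eq_zero h]
  · simp only [IsLambdaLength, h, false_and, not_false_eq_true, true_and, false_or]
    constructor
    · rintro ⟨q, q', d, -, -, hd, rfl⟩
      exact exp_half_eq_pairing hd
    · rintro rfl
      obtain ⟨q, q', d, hq, hq', hd⟩ := exists_isComplexDistance h
      exact ⟨q, q', d, hq, hq', hd, (exp_half_eq_pairing hd).symm⟩

end SpinDecoratedHorosphere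

end SpinHoro

theorem theorem1p4 (D : Fin 4 → SpinHoro.SpinDecoratedHorosphere) :
    (∀ i j, ∃! z : ℂ, SpinHoro.IsLambdaLength (D i) (D j) z) ∧
    ∀ lam : Fin 4 → Fin 4 → ℂ,
      (∀ i j, SpinHoro.IsLambdaLength (D i) (D j) (lam i j)) →
        lam 0 2 * lam 1 3 = lam 0 1 * lam 2 3 + lam 0 3 * lam 1 2 := by
  simp only [SpinHoro.SpinDecoratedHorosphere.isLambdaLength_iff]
  refine ⟨fun i j => existsUnique_eq, fun lam h => ?_⟩
  simp only [h, SpinHoro.SpinDecoratedHorosphere.pairing]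
  -- The Plücker relation for four vectors of ℂ².
  ring
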